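/- Let $\mathcal X$ and $\mathcal Y$ be Banach spaces over the same scalar field $\mathbb K\in\{\mathbb R,\mathbb C\}$; all operators are bounded and linear, and invertible operators have bounded inverses. An operator $T:\mathcal V\to\mathcal W$ between Banach spaces is called inessential if $I-ST$ is Fredholm for every operator $S:\mathcal W\to\mathcal V$. Operators $U$ on $\mathcal X$ and $V$ on $\mathcal Y$ are called - equivalent after extension (EAE) if there are Banach spaces $\mathcal X_0,\mathcal Y_0$ and invertible operators $E:\mathcal Y\oplus\mathcal Y_0\to\mathcal X\oplus\mathcal X_0$ and $F:\mathcal X\oplus\mathcal X_0\to\mathcal Y\oplus\mathcal Y_0$ such that $$\begin{pmatrix}U&0\\0&I_{\mathcal X_0}\end{pmatrix}=E\begin{pmatrix}V&0\\0&I_{\mathcal Y_0}\end{pmatrix}F;$$ - equivalent after one-sided extension (EAOE) if this holds for some such $\mathcal X_0,\mathcal Y_0,E,F$ with $\mathcal X_0=\{0\}$ or $\mathcal Y_0=\{0\}$; - Schur coupled (SC) if there is an operator $\begin{pmatrix}A&B\\C&D\end{pmatrix}$ on $\mathcal X\oplus\mathcal Y$ with $A$ and $D$ invertible such that $U=A-BD^{-1}C$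 and $V=D-CA^{-1}B$. **Theorem.** Let $U$ on $\mathcal X$ and $V$ on $\mathcal Y$ be inessential operators. Then $$U\text{ and }V\text{ are EAE}\iff U\text{ and }V\text{ are EAOE}\iff U\text{ and }V\text{ are SC}.$$ Moreover, in this case the extension spaces $\mathcal X_0,\mathcal Y_0$ in EAE, and likewise in EAOE, can be chosen finite dimensional. -/

import Mathlib

universe w k u v

/-- A bounded operator `T : V → W` is inessential if `I - S T` is Fredholm for every bounded
operator `S : W → V`. -/
def IsInessential {𝕜 V W : Type*} [RCLike 𝕜]
    [NormedAddCommGroup V] [NormedSpace 𝕜 V] [NormedAddCommGroup W] [NormedSpace 𝕜 W]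
    (T : V →L[𝕜] W) : Prop :=
  ∀ S : W →L[𝕜] V, (ContinuousLinearMap.id 𝕜 V - S ∘L T).IsFredholm

/-- `U ⊕ I_{X₀}` and `V ⊕ I_{Y₀}` are equivalent: `U ⊕ I_{X₀} = E (V ⊕ I_{Y₀}) F` for some
invertible bounded operators `E : Y ⊕ Y₀ → X ⊕ X₀` and `F : X ⊕ X₀ → Y ⊕ Y₀`. -/
def EquivalentWithExtensions {𝕜 X Y : Type*} [RCLike 𝕜]
    [NormedAddCommGroup X] [NormedSpace 𝕜 X] [NormedAddCommGroup Y] [NormedSpace 𝕜 Y]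
    (U : X →L[𝕜] X) (V : Y →L[𝕜] Y)
    (X₀ Y₀ : Type*) [NormedAddCommGroup X₀] [NormedSpace 𝕜 X₀]
    [NormedAddCommGroup Y₀] [NormedSpace 𝕜 Y₀] : Prop :=
  ∃ (E : (Y × Y₀) ≃L[𝕜] (X × X₀)) (F : (X × X₀) ≃L[𝕜] (Y × Y₀)),
    U.prodMap (ContinuousLinearMap.id 𝕜 X₀) =
      (E : (Y × Y₀) →L[𝕜] (X × X₀)) ∘L
        V.prodMap (ContinuousLinearMap.id 𝕜 Y₀) ∘L (F : (X × X₀) →L[𝕜] (Y × Y₀))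

/-- Equivalence after extension. The extension spaces range over the Banach spaces of an
arbitrary universe `w`. -/
def EAE {𝕜 : Type k} {X : Type u} {Y : Type v} [RCLike 𝕜]
    [NormedAddCommGroup X] [NormedSpace 𝕜 X] [NormedAddCommGroup Y] [NormedSpace 𝕜 Y]
    (U : X →L[𝕜] X) (V : Y →L[𝕜] Y) : Prop :=
  ∃ (X₀ : Type w) (_ : NormedAddCommGroup X₀) (_ : NormedSpace 𝕜 X₀) (_ : CompleteSpace X₀)
    (Y₀ : Type w) (_ : NormedAddCommGroup Y₀) (_ : NormedSpace 𝕜 Y₀) (_ : CompleteSpace Y₀),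
    EquivalentWithExtensions U V X₀ Y₀

/-- Equivalence after one-sided extension: one of the two extension spaces is `{0}`. -/
def EAOE {𝕜 : Type k} {X : Type u} {Y : Type v} [RCLike 𝕜]
    [NormedAddCommGroup X] [NormedSpace 𝕜 X] [NormedAddCommGroup Y] [NormedSpace 𝕜 Y]
    (U : X →L[𝕜] X) (V : Y →L[𝕜] Y) : Prop :=
  ∃ (X₀ : Type w) (_ : NormedAddCommGroup X₀) (_ : NormedSpace 𝕜 X₀) (_ : CompleteSpace X₀)
    (Y₀ : Type w) (_ : NormedAddCommGroup Y₀) (_ : NormedSpace 𝕜 Y₀) (_ : CompleteSpace Y₀),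
    (Subsingleton X₀ ∨ Subsingleton Y₀) ∧ EquivalentWithExtensions U V X₀ Y₀

/-- Equivalence after extension, with finite dimensional extension spaces. -/
def FiniteDimensionalEAE {𝕜 : Type k} {X : Type u} {Y : Type v} [RCLike 𝕜]
    [NormedAddCommGroup X] [NormedSpace 𝕜 X] [NormedAddCommGroup Y] [NormedSpace 𝕜 Y]
    (U : X →L[𝕜] X) (V : Y →L[𝕜] Y) : Prop :=
  ∃ (X₀ : Type w) (_ : NormedAddCommGroup X₀) (_ : NormedSpace 𝕜 X₀) (_ : CompleteSpace X₀)
    (Y₀ : Type w) (_ : NormedAddCommGroup Y₀) (_ : NormedSpace 𝕜 Y₀) (_ : CompleteSpace Y₀),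
    FiniteDimensional 𝕜 X₀ ∧ FiniteDimensional 𝕜 Y₀ ∧ EquivalentWithExtensions U V X₀ Y₀

/-- Equivalence after one-sided extension, with finite dimensional extension spaces. -/
def FiniteDimensionalEAOE {𝕜 : Type k} {X : Type u} {Y : Type v} [RCLike 𝕜]
    [NormedAddCommGroup X] [NormedSpace 𝕜 X] [NormedAddCommGroup Y] [NormedSpace 𝕜 Y]
    (U : X →L[𝕜] X) (V : Y →L[𝕜] Y) : Prop :=
  ∃ (X₀ : Type w) (_ : NormedAddCommGroup X₀) (_ : NormedSpace 𝕜 X₀) (_ : CompleteSpace X₀)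
    (Y₀ : Type w) (_ : NormedAddCommGroup Y₀) (_ : NormedSpace 𝕜 Y₀) (_ : CompleteSpace Y₀),
    (Subsingleton X₀ ∨ Subsingleton Y₀) ∧
      FiniteDimensional 𝕜 X₀ ∧ FiniteDimensional 𝕜 Y₀ ∧ EquivalentWithExtensions U V X₀ Y₀

/-- Schur coupling: `U = A - B D⁻¹ C` and `V = D - C A⁻¹ B` for the blocks of a bounded operator
`[A B; C D]` on `X ⊕ Y` with `A` and `D` invertible. -/
def SchurCoupled {𝕜 X Y : Type*} [RCLike 𝕜]
    [NormedAddCommGroup X] [NormedSpace 𝕜 X] [NormedAddCommGroup Y] [NormedSpace 𝕜 Y]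
    (U : X →L[𝕜] X) (V : Y →L[𝕜] Y) : Prop :=
  ∃ (A : X ≃L[𝕜] X) (B : Y →L[𝕜] X) (C : X →L[𝕜] Y) (D : Y ≃L[𝕜] Y),
    U = (A : X →L[𝕜] X) - B ∘L (D.symm : Y →L[𝕜] Y) ∘L C ∧
    V = (D : Y →L[𝕜] Y) - C ∘L (A.symm : X →L[𝕜] X) ∘L B

/-!
The argument rests on one cancellation mechanism and does not use the index of a Fredholm operator.

Write an equivalence after extension as `(U ⊕ I) G = E (V ⊕ I)` with `E, G : Y ⊕ Y₀ → X ⊕ X₀`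
invertible. Comparing blocks, the upper right corner of `E` is `U G₁₂`, the lower left corner of `G`
is `E₂₁ V`, and `E` and `G` have the same lower right corner `T : Y₀ → X₀`.

* If `T` is invertible, the Schur complements of `T` in `E` and in `G` are invertible, and they
  intertwine `U` and `V`: the extensions cancel (`equivalent_of_corner`).
* If `U` and `V` are inessential, the identities `E⁻¹ E = I` and `G G⁻¹ = I` show that `T` is
  invertible from the left and from the right up to Fredholm operators, hence Fredholm
  (`isFredholm_corner`). Splitting off its kernel and a complement of its range leaves an
  isomorphism between the remaining parts of `Y₀` and `X₀`; these cancel, and what is left are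
  finite dimensional extension spaces (`exists_finiteDimensional_extensions`).
* If `X₀ = Y₀ = 𝕜`, the corner `T` is a scalar. When it vanishes, a shear given by a functional on
  `X` commutes past `U ⊕ I` and makes it nonzero, so one dimension can always be cancelled
  (`equivalent_of_prod_scalars`). Hence finite dimensional extensions become one-sided.

The passage from a one-sided extension to a Schur coupling, and from a Schur coupling to an
extension of `U` by `Y` and of `V` by `X`, is by explicit operator matrices
(`schurCoupled_prod_id`, `SchurCoupled.equivalentWithExtensions`). The reduction above then replaces
these extension spaces by finite dimensional ones, which exist in every universe.
-/

open scoped LinearMap.FiniteRangeSetoid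

/-! ### Fredholm operators -/

section Fredholm

variable {𝕜 E F : Type*} [RCLike 𝕜] [NormedAddCommGroup E] [NormedSpace 𝕜 E]
  [NormedAddCommGroup F] [NormedSpace 𝕜 F]

theorem ContinuousLinearMap.IsFredholm.of_comp_comp {T : E →L[𝕜] F} {L R : F →L[𝕜] E}
    (hL : (L ∘L T).IsFredholm) (hR : (T ∘L R).IsFredholm) : T.IsFredholm := by
  obtain ⟨W, hW, -⟩ := hL.exists_isQuasiInverse
  obtain ⟨W', -, hW'⟩ := hR.exists_isQuasiInverse
  replace hW : (W : E →ₗ[𝕜] E) ∘ₗ (L : F →ₗ[𝕜] E) ∘ₗ (T : E →ₗ[𝕜] F) ≈ .id := hW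
  replace hW' : ((T : E →ₗ[𝕜] F) ∘ₗ (R : F →ₗ[𝕜] E)) ∘ₗ (W' : F →ₗ[𝕜] F) ≈ .id := hW'
  have key : (R : F →ₗ[𝕜] E) ∘ₗ (W' : F →ₗ[𝕜] F) ≈ (W : E →ₗ[𝕜] E) ∘ₗ (L : F →ₗ[𝕜] E) := by
    calc (R : F →ₗ[𝕜] E) ∘ₗ (W' : F →ₗ[𝕜] F)
        = .id ∘ₗ ((R : F →ₗ[𝕜] E) ∘ₗ (W' : F →ₗ[𝕜] F)) := by simp
      _ ≈ ((W : E →ₗ[𝕜] E) ∘ₗ (L : F →ₗ[𝕜] E) ∘ₗ (T : E →ₗ[𝕜] F)) ∘ₗ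
            ((R : F →ₗ[𝕜] E) ∘ₗ (W' : F →ₗ[𝕜] F)) := by grw [hW]
      _ = ((W : E →ₗ[𝕜] E) ∘ₗ (L : F →ₗ[𝕜] E)) ∘ₗ
            (((T : E →ₗ[𝕜] F) ∘ₗ (R : F →ₗ[𝕜] E)) ∘ₗ (W' : F →ₗ[𝕜] F)) := rfl
      _ ≈ ((W : E →ₗ[𝕜] E) ∘ₗ (L : F →ₗ[𝕜] E)) ∘ₗ .id := by grw [hW']
      _ = (W : E →ₗ[𝕜] E) ∘ₗ (L : F →ₗ[𝕜] E) := by simp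
  refine .of_isQuasiInverse (v := R ∘L W') ⟨?_, hW'⟩
  calc ((R : F →ₗ[𝕜] E) ∘ₗ (W' : F →ₗ[𝕜] F)) ∘ₗ (T : E →ₗ[𝕜] F)
      ≈ ((W : E →ₗ[𝕜] E) ∘ₗ (L : F →ₗ[𝕜] E)) ∘ₗ (T : E →ₗ[𝕜] F) := by grw [key]
    _ ≈ .id := hW

/-- A quasi-inverse of `I - A B` is `I + A W B`, where `W` is a quasi-inverse of `I - B A`. -/
theorem ContinuousLinearMap.IsFredholm.id_sub_comp_swap {A : E →L[𝕜] F} {B : F →L[𝕜] E}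
    (h : (ContinuousLinearMap.id 𝕜 E - B ∘L A).IsFredholm) :
    (ContinuousLinearMap.id 𝕜 F - A ∘L B).IsFredholm := by
  obtain ⟨W, hl, hr⟩ := h.exists_isQuasiInverse
  have hl' := (LinearMap.FiniteRangeSetoid.equiv_iff_hasNoetherianRange.1 hl)
  have hr' := (LinearMap.FiniteRangeSetoid.equiv_iff_hasNoetherianRange.1 hr)
  refine .of_isQuasiInverse (v := ContinuousLinearMap.id 𝕜 F + A ∘L W ∘L B) ⟨?_, ?_⟩
  · refine LinearMap.FiniteRangeSetoid.equiv_iff_hasNoetherianRange.2 ?_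
    refine (congrArg LinearMap.HasNoetherianRange (LinearMap.ext fun x ↦ ?_)).mpr
      ((hl'.comp_left (A : E →ₗ[𝕜] F)).comp_right (B : F →ₗ[𝕜] E))
    simp
    abel
  · refine LinearMap.FiniteRangeSetoid.equiv_iff_hasNoetherianRange.2 ?_
    refine (congrArg LinearMap.HasNoetherianRange (LinearMap.ext fun x ↦ ?_)).mpr
      ((hr'.comp_left (A : E →ₗ[𝕜] F)).comp_right (B : F →ₗ[𝕜] E))
    simp
    abel

end Fredholm

/-! ### Equivalence of operators -/

/-- `U` and `V` are equivalent: `U f = e V` for some invertible bounded `e, f : Y → X`. -/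
def EquivalentOperators {𝕜 X Y : Type*} [RCLike 𝕜]
    [NormedAddCommGroup X] [NormedSpace 𝕜 X] [NormedAddCommGroup Y] [NormedSpace 𝕜 Y]
    (U : X →L[𝕜] X) (V : Y →L[𝕜] Y) : Prop :=
  ∃ e f : Y ≃L[𝕜] X, ∀ y, U (f y) = e (V y)

section Equivalence

variable {𝕜 X Y Z X₀ Y₀ X₁ Y₁ : Type*} [RCLike 𝕜]
  [NormedAddCommGroup X] [NormedSpace 𝕜 X] [NormedAddCommGroup Y] [NormedSpace 𝕜 Y]
  [NormedAddCommGroup Z] [NormedSpace 𝕜 Z]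
  [NormedAddCommGroup X₀] [NormedSpace 𝕜 X₀] [NormedAddCommGroup Y₀] [NormedSpace 𝕜 Y₀]
  [NormedAddCommGroup X₁] [NormedSpace 𝕜 X₁] [NormedAddCommGroup Y₁] [NormedSpace 𝕜 Y₁]
  {U : X →L[𝕜] X} {V : Y →L[𝕜] Y} {W : Z →L[𝕜] Z}

theorem EquivalentOperators.symm (h : EquivalentOperators U V) : EquivalentOperators V U := by
  obtain ⟨e, f, h⟩ := h
  refine ⟨e.symm, f.symm, fun x ↦ ?_⟩
  rw [ContinuousLinearEquiv.eq_symm_apply, ← h, f.apply_symm_apply]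

theorem EquivalentOperators.trans (h : EquivalentOperators U V) (h' : EquivalentOperators V W) :
    EquivalentOperators U W := by
  obtain ⟨e, f, h⟩ := h
  obtain ⟨e', f', h'⟩ := h'
  exact ⟨e'.trans e, f'.trans f, fun z ↦ by simp [h, h']⟩

theorem equivalentWithExtensions_iff :
    EquivalentWithExtensions U V X₀ Y₀ ↔
      EquivalentOperators (U.prodMap (.id 𝕜 X₀)) (V.prodMap (.id 𝕜 Y₀)) := by
  constructor
  · rintro ⟨E, F, h⟩
    refine ⟨E, F.symm, fun y ↦ ?_⟩
    have := DFunLike.congr_fun h (F.symm y)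
    simpa using this
  · rintro ⟨e, f, h⟩
    refine ⟨e, f.symm, ?_⟩
    refine ContinuousLinearMap.ext fun x ↦ ?_
    have := h (f.symm x)
    simpa using this

theorem equivalent_prodMap_id_congr (U : X →L[𝕜] X) (φ : X₁ ≃L[𝕜] X₀) :
    EquivalentOperators (U.prodMap (.id 𝕜 X₀)) (U.prodMap (.id 𝕜 X₁)) :=
  ⟨(ContinuousLinearEquiv.refl 𝕜 X).prodCongr φ, (ContinuousLinearEquiv.refl 𝕜 X).prodCongr φ,
    fun y ↦ by simp⟩

theorem equivalent_prodMap_id_prod (U : X →L[𝕜] X) :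
    EquivalentOperators (U.prodMap (.id 𝕜 (X₀ × X₁)))
      ((U.prodMap (.id 𝕜 X₀)).prodMap (.id 𝕜 X₁)) :=
  ⟨.prodAssoc 𝕜 X X₀ X₁, .prodAssoc 𝕜 X X₀ X₁, fun _ ↦ rfl⟩

theorem equivalent_prodMap_id_subsingleton [Subsingleton X₀] (U : X →L[𝕜] X) :
    EquivalentOperators U (U.prodMap (.id 𝕜 X₀)) := by
  have : Unique X₀ := uniqueOfSubsingleton 0
  exact ⟨.prodUnique 𝕜 X X₀, .prodUnique 𝕜 X X₀, fun _ ↦ rfl⟩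

theorem EquivalentWithExtensions.congr_extensions (h : EquivalentWithExtensions U V X₀ Y₀)
    (φ : X₀ ≃L[𝕜] X₁) (ψ : Y₀ ≃L[𝕜] Y₁) : EquivalentWithExtensions U V X₁ Y₁ :=
  equivalentWithExtensions_iff.2 <| ((equivalent_prodMap_id_congr U φ).trans
    (equivalentWithExtensions_iff.1 h)).trans (equivalent_prodMap_id_congr V ψ.symm)

/-! ### Cancelling an invertible corner -/

/-- If the lower right corner `T` of the invertible matrix `E` is invertible, so is its Schur
complement `e` in `E`; the inverse of `e` is the upper left corner of `E⁻¹`. -/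
theorem exists_schurComplement (E : (Y × Y₀) ≃L[𝕜] (X × X₀)) (T : Y₀ ≃L[𝕜] X₀)
    (hT : ∀ z, (E (0, z)).2 = T z) :
    ∃ e : Y ≃L[𝕜] X, ∀ x, e.symm x = (E.symm (x, 0)).1 := by
  have hE (y : Y) (z : Y₀) : (E (y, z)).2 = (E (y, 0)).2 + T z := by
    rw [← hT, ← Prod.snd_add, ← map_add]; simp
  let f : Y →L[𝕜] X := .fst 𝕜 X X₀ ∘L (E : (Y × Y₀) →L[𝕜] (X × X₀)) ∘L
    (ContinuousLinearMap.id 𝕜 Y).prod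
      (-((T.symm : X₀ →L[𝕜] Y₀) ∘L .snd 𝕜 X X₀ ∘L (E : (Y × Y₀) →L[𝕜] (X × X₀)) ∘L .inl 𝕜 Y Y₀))
  let g : X →L[𝕜] Y := .fst 𝕜 Y Y₀ ∘L (E.symm : (X × X₀) →L[𝕜] (Y × Y₀)) ∘L .inl 𝕜 X X₀
  have hf (y : Y) : f y = (E (y, -T.symm (E (y, 0)).2)).1 := by simp [f]
  refine ⟨.equivOfInverse f g (fun y ↦ ?_) (fun x ↦ ?_), fun x ↦ rfl⟩
  · have : E (y, -T.symm (E (y, 0)).2) = (f y, 0) := by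
      ext
      · exact (hf y).symm
      · rw [hE]; simp
    change (E.symm (f y, 0)).1 = y
    rw [← this, E.symm_apply_apply]
  · have h1 : E (g x, (E.symm (x, 0)).2) = (x, 0) := by
      change E (E.symm (x, 0)) = _
      simp
    have h2 : (E.symm (x, 0)).2 = -T.symm (E (g x, 0)).2 := by
      have := hE (g x) (E.symm (x, 0)).2
      rw [h1] at this
      rw [← map_neg, ContinuousLinearEquiv.eq_symm_apply]
      exact (neg_eq_of_add_eq_zero_right this.symm).symm
    rw [hf, ← h2, h1]

/-- Extensions by identities cancel when the lower right corner of `E` is invertible: `U` and `V`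
are intertwined by the Schur complements of that corner. -/
theorem equivalent_of_corner (E G : (Y × Y₀) ≃L[𝕜] (X × X₀))
    (h : ∀ p, U.prodMap (.id 𝕜 X₀) (G p) = E (V.prodMap (.id 𝕜 Y₀) p)) (T : Y₀ ≃L[𝕜] X₀)
    (hT : ∀ z, (E (0, z)).2 = T z) : EquivalentOperators U V := by
  have hG (z : Y₀) : (G (0, z)).2 = T z := by
    rw [← hT]
    simpa using congrArg Prod.snd (h (0, z))
  obtain ⟨e, he⟩ := exists_schurComplement E T hT
  obtain ⟨f, hf⟩ := exists_schurComplement G T hG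
  refine ⟨e, f, fun y ↦ ?_⟩
  have h1 : G (y, (G.symm (f y, 0)).2) = (f y, 0) := by
    have : G.symm (f y, 0) = (y, (G.symm (f y, 0)).2) := by
      ext
      · rw [← hf, f.symm_apply_apply]
      · rfl
    rw [← this, G.apply_symm_apply]
  have h2 := h (y, (G.symm (f y, 0)).2)
  rw [h1] at h2
  replace h2 : (U (f y), 0) = E (V y, (G.symm (f y, 0)).2) := h2
  rw [← ContinuousLinearEquiv.symm_apply_eq, he, h2, E.symm_apply_apply]

/-! ### Reduction to finite dimensional extensions -/

/-- The lower right corner of an equivalence between extensions of inessential operators is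
Fredholm: up to Fredholm factors it is inverted by the corresponding corners of `E⁻¹` and `G⁻¹`. -/
theorem isFredholm_corner (hU : IsInessential U) (hV : IsInessential V)
    (E G : (Y × Y₀) ≃L[𝕜] (X × X₀))
    (h : ∀ p, U.prodMap (.id 𝕜 X₀) (G p) = E (V.prodMap (.id 𝕜 Y₀) p)) :
    (.snd 𝕜 X X₀ ∘L (E : (Y × Y₀) →L[𝕜] (X × X₀)) ∘L .inr 𝕜 Y Y₀ : Y₀ →L[𝕜] X₀).IsFredholm := by
  have hE12 (z : Y₀) : (E (0, z)).1 = U (G (0, z)).1 := by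
    simpa using (congrArg Prod.fst (h (0, z))).symm
  have hG21 (y : Y) : (G (y, 0)).2 = (E (V y, 0)).2 := by
    simpa using congrArg Prod.snd (h (y, 0))
  have hG22 (z : Y₀) : (G (0, z)).2 = (E (0, z)).2 := by
    simpa using congrArg Prod.snd (h (0, z))
  let E21 : Y →L[𝕜] X₀ := .snd 𝕜 X X₀ ∘L (E : (Y × Y₀) →L[𝕜] (X × X₀)) ∘L .inl 𝕜 Y Y₀
  let G12 : Y₀ →L[𝕜] X := .fst 𝕜 X X₀ ∘L (G : (Y × Y₀) →L[𝕜] (X × X₀)) ∘L .inr 𝕜 Y Y₀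
  let e21 : X →L[𝕜] Y₀ := .snd 𝕜 Y Y₀ ∘L (E.symm : (X × X₀) →L[𝕜] (Y × Y₀)) ∘L .inl 𝕜 X X₀
  let e22 : X₀ →L[𝕜] Y₀ := .snd 𝕜 Y Y₀ ∘L (E.symm : (X × X₀) →L[𝕜] (Y × Y₀)) ∘L .inr 𝕜 X X₀
  let g12 : X₀ →L[𝕜] Y := .fst 𝕜 Y Y₀ ∘L (G.symm : (X × X₀) →L[𝕜] (Y × Y₀)) ∘L .inr 𝕜 X X₀
  let g22 : X₀ →L[𝕜] Y₀ := .snd 𝕜 Y Y₀ ∘L (G.symm : (X × X₀) →L[𝕜] (Y × Y₀)) ∘L .inr 𝕜 X X₀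
  refine .of_comp_comp (L := e22) (R := g22) ?_ ?_
  · have hF := (hU (G12 ∘L e21)).id_sub_comp_swap (A := e21 ∘L U) (B := G12)
    convert hF using 1
    ext z
    have key : (E.symm ((E (0, z)).1, 0)).2 + (E.symm (0, (E (0, z)).2)).2 = z := by
      rw [← Prod.snd_add, ← map_add]; simp
    rw [hE12] at key
    simpa [e21, e22, G12] using eq_sub_of_add_eq' key
  · have hF := (hV (g12 ∘L E21)).id_sub_comp_swap (A := E21 ∘L V) (B := g12)
    convert hF using 1
    ext x
    have key : (G ((G.symm (0, x)).1, 0)).2 + (G (0, (G.symm (0, x)).2)).2 = x := by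
      rw [← Prod.snd_add, ← map_add]; simp
    rw [hG21, hG22] at key
    simpa [E21, g12, g22] using eq_sub_of_add_eq' key

theorem exists_finiteDimensional_extensions (hU : IsInessential U) (hV : IsInessential V)
    (h : EquivalentWithExtensions U V X₀ Y₀) :
    ∃ (N' : Submodule 𝕜 X₀) (N : Submodule 𝕜 Y₀), FiniteDimensional 𝕜 N' ∧
      FiniteDimensional 𝕜 N ∧ EquivalentWithExtensions U V N' N := by
  obtain ⟨E, G, h⟩ := equivalentWithExtensions_iff.1 h
  obtain ⟨pkg⟩ := (isFredholm_corner hU hV E G h).nonempty_fredholmPackage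
  refine ⟨pkg.decCodom.X₀, pkg.decDom.X₀, pkg.decCodom.finite_X₀, pkg.decDom.finite_X₀, ?_⟩
  -- Split `Y₀` and `X₀` into inessential and essential parts, the latter regarded as the extension.
  let φ : (pkg.decDom.X₀ × pkg.decDom.X₁) ≃L[𝕜] Y₀ :=
    Submodule.prodEquivOfIsTopCompl _ _ pkg.decDom.isTopCompl.symm
  let ψ : (pkg.decCodom.X₀ × pkg.decCodom.X₁) ≃L[𝕜] X₀ :=
    Submodule.prodEquivOfIsTopCompl _ _ pkg.decCodom.isTopCompl.symm
  let α : ((Y × pkg.decDom.X₀) × pkg.decDom.X₁) ≃L[𝕜] (Y × Y₀) :=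
    (ContinuousLinearEquiv.prodAssoc 𝕜 _ _ _).trans ((ContinuousLinearEquiv.refl 𝕜 Y).prodCongr φ)
  let β : ((X × pkg.decCodom.X₀) × pkg.decCodom.X₁) ≃L[𝕜] (X × X₀) :=
    (ContinuousLinearEquiv.prodAssoc 𝕜 _ _ _).trans ((ContinuousLinearEquiv.refl 𝕜 X).prodCongr ψ)
  have hα (p) : α ((V.prodMap (.id 𝕜 pkg.decDom.X₀)).prodMap (.id 𝕜 pkg.decDom.X₁) p) =
      V.prodMap (.id 𝕜 Y₀) (α p) := rfl
  have hβ (p) : β ((U.prodMap (.id 𝕜 pkg.decCodom.X₀)).prodMap (.id 𝕜 pkg.decCodom.X₁) p) =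
      U.prodMap (.id 𝕜 X₀) (β p) := rfl
  refine equivalentWithExtensions_iff.2 <| equivalent_of_corner ((α.trans E).trans β.symm)
    ((α.trans G).trans β.symm) (fun p ↦ ?_) pkg.equiv (fun z ↦ ?_)
  · apply β.injective
    rw [hβ]
    simp only [ContinuousLinearEquiv.trans_apply, ContinuousLinearEquiv.apply_symm_apply]
    rw [h, hα]
  · have hz : (E (0, (z : Y₀))).2 = pkg.equiv z := by
      have := DFunLike.congr_fun pkg.eq_equiv (z : Y₀)
      simpa using this
    have hψ : ψ (0, pkg.equiv z) = (E (0, (z : Y₀))).2 := by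
      rw [hz]; simp [ψ, Submodule.prodEquivOfIsTopCompl_apply]
    have hα0 : α (0, z) = (0, (z : Y₀)) := by
      simp [α, φ, Submodule.prodEquivOfIsTopCompl_apply]
    have hβ0 : E (0, (z : Y₀)) = β (((E (0, (z : Y₀))).1, 0), pkg.equiv z) := by
      ext
      · rfl
      · exact hψ.symm
    simp only [ContinuousLinearEquiv.trans_apply]
    rw [hα0, hβ0, β.symm_apply_apply]

/-! ### Cancelling finite dimensional extensions -/

theorem equivalent_of_prod_scalars
    (h : EquivalentOperators (U.prodMap (.id 𝕜 𝕜)) (V.prodMap (.id 𝕜 𝕜))) :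
    EquivalentOperators U V := by
  obtain ⟨E, G, h⟩ := h
  -- A scalar corner is invertible as soon as it is nonzero.
  have corner (E' G' : (Y × 𝕜) ≃L[𝕜] (X × 𝕜))
      (h' : ∀ p, U.prodMap (.id 𝕜 𝕜) (G' p) = E' (V.prodMap (.id 𝕜 𝕜) p))
      (hne : (E' (0, 1)).2 ≠ 0) : EquivalentOperators U V := by
    refine equivalent_of_corner E' G' h'
      (ContinuousLinearEquiv.unitsEquivAut 𝕜 (Units.mk0 _ hne)) fun z ↦ ?_
    have : ((0, z) : Y × 𝕜) = z • (0, 1) := by simp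
    rw [this, map_smul]
    simp
  by_cases h0 : (E (0, 1)).2 = 0
  · have hx : (E (0, 1)).1 ≠ 0 := fun hx ↦ by
      have : E (0, 1) = 0 := Prod.ext hx h0
      simp at this
    obtain ⟨b, -, hb⟩ := exists_dual_vector 𝕜 _ (norm_ne_zero_iff.2 hx)
    -- The shear `(x, t) ↦ (x, t + b x)` satisfies `P (U ⊕ I) = (U ⊕ I) Q` with `Q` the shear by
    -- `b U`, and it turns the corner into `b (E₁₂ 1)`, which is nonzero.
    let P : (X × 𝕜) ≃L[𝕜] (X × 𝕜) := (ContinuousLinearEquiv.refl 𝕜 X).skewProd (.refl 𝕜 𝕜) b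
    let Q : (X × 𝕜) ≃L[𝕜] (X × 𝕜) :=
      (ContinuousLinearEquiv.refl 𝕜 X).skewProd (.refl 𝕜 𝕜) (b ∘L U)
    refine corner (E.trans P) (G.trans Q) (fun p ↦ ?_) ?_
    · rw [ContinuousLinearEquiv.trans_apply E P, ← h]
      simp [P, Q]
    · simp [P, h0, hb, hx]
  · exact corner E G h h0

theorem EquivalentWithExtensions.cancel_pi {n m : ℕ}
    (h : EquivalentWithExtensions U V (Fin n → 𝕜) (Fin m → 𝕜)) :
    EquivalentWithExtensions U V (Fin (n - m) → 𝕜) (Fin (m - n) → 𝕜) := by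
  induction n generalizing m with
  | zero => rwa [Nat.zero_sub, Nat.sub_zero]
  | succ n ih =>
    cases m with
    | zero => rwa [Nat.zero_sub, Nat.sub_zero]
    | succ m =>
      have split (k : ℕ) : Nonempty ((Fin (k + 1) → 𝕜) ≃L[𝕜] ((Fin k → 𝕜) × 𝕜)) :=
        FiniteDimensional.nonempty_continuousLinearEquiv_of_finrank_eq (by simp)
      obtain ⟨φ⟩ := split n
      obtain ⟨ψ⟩ := split m
      have h' := equivalentWithExtensions_iff.1 (h.congr_extensions φ ψ)
      have := ih (equivalentWithExtensions_iff.2 <| equivalent_of_prod_scalars <|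
        ((equivalent_prodMap_id_prod U).symm.trans h').trans (equivalent_prodMap_id_prod V))
      rwa [Nat.add_sub_add_right, Nat.add_sub_add_right]

theorem RCLike.small (𝕜 : Type*) [RCLike 𝕜] : Small.{w} 𝕜 := by
  refine small_of_injective (β := ℝ × ℝ) (f := fun z : 𝕜 ↦ (RCLike.re z, RCLike.im z))
    fun a b hab ↦ ?_
  rw [Prod.mk.injEq] at hab
  exact RCLike.ext hab.1 hab.2

end Equivalence

/-- Operators that are inessential and equivalent after any extension, with extension spaces in any
universes, are equivalent after a finite dimensional one-sided extension within a given universe. -/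
theorem EquivalentWithExtensions.finiteDimensionalEAOE {𝕜 : Type k} {X : Type u} {Y : Type v}
    {X₀ Y₀ : Type*} [RCLike 𝕜]
    [NormedAddCommGroup X] [NormedSpace 𝕜 X] [NormedAddCommGroup Y] [NormedSpace 𝕜 Y]
    [NormedAddCommGroup X₀] [NormedSpace 𝕜 X₀] [NormedAddCommGroup Y₀] [NormedSpace 𝕜 Y₀]
    {U : X →L[𝕜] X} {V : Y →L[𝕜] Y} (hU : IsInessential U) (hV : IsInessential V)
    (h : EquivalentWithExtensions U V X₀ Y₀) : FiniteDimensionalEAOE.{w, k, u, v} U V := by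
  obtain ⟨N', N, hN', hN, h⟩ := exists_finiteDimensional_extensions hU hV h
  obtain ⟨φ⟩ := FiniteDimensional.nonempty_continuousLinearEquiv_of_finrank_eq (𝕜 := 𝕜)
    (E := N') (F := Fin (Module.finrank 𝕜 N') → 𝕜) (by simp)
  obtain ⟨ψ⟩ := FiniteDimensional.nonempty_continuousLinearEquiv_of_finrank_eq (𝕜 := 𝕜)
    (E := N) (F := Fin (Module.finrank 𝕜 N) → 𝕜) (by simp)
  have h := (h.congr_extensions φ ψ).cancel_pi
  set n := Module.finrank 𝕜 N'
  set m := Module.finrank 𝕜 N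
  -- The coordinate spaces live in the universe of `𝕜`; they have copies in every universe.
  have : Small.{w} 𝕜 := RCLike.small 𝕜
  have shrink (j : ℕ) : FiniteDimensional 𝕜 (Shrink.{w} (Fin j → 𝕜)) :=
    (Shrink.linearEquiv 𝕜 (Fin j → 𝕜)).symm.finiteDimensional
  have complete (j : ℕ) : CompleteSpace (Shrink.{w} (Fin j → 𝕜)) := FiniteDimensional.complete 𝕜 _
  refine ⟨Shrink.{w} (Fin (n - m) → 𝕜), inferInstance, inferInstance, complete _,
    Shrink.{w} (Fin (m - n) → 𝕜), inferInstance, inferInstance, complete _, ?_, shrink _, shrink _,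
    h.congr_extensions (Shrink.linearEquiv 𝕜 _).symm.toContinuousLinearEquiv
      (Shrink.linearEquiv 𝕜 _).symm.toContinuousLinearEquiv⟩
  rcases le_total n m with hnm | hnm
  · left
    rw [Nat.sub_eq_zero_of_le hnm]
    exact (equivShrink _).symm.subsingleton
  · right
    rw [Nat.sub_eq_zero_of_le hnm]
    exact (equivShrink _).symm.subsingleton

/-! ### Schur coupling -/

section Schur

variable {𝕜 X Y X₀ Y₀ : Type*} [RCLike 𝕜]
  [NormedAddCommGroup X] [NormedSpace 𝕜 X] [NormedAddCommGroup Y] [NormedSpace 𝕜 Y]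
  [NormedAddCommGroup X₀] [NormedSpace 𝕜 X₀] [NormedAddCommGroup Y₀] [NormedSpace 𝕜 Y₀]
  {U : X →L[𝕜] X} {V : Y →L[𝕜] Y}

theorem SchurCoupled.symm (h : SchurCoupled U V) : SchurCoupled V U := by
  obtain ⟨A, B, C, D, hU, hV⟩ := h
  exact ⟨D, C, B, A, hV, hU⟩

/-- The coupling matrix has the diagonal blocks `A = I`, `D = I` and the off-diagonal blocks
`B = (I - V, 0)ᵗ`, `C = (I, 0)`. -/
theorem schurCoupled_prod_id (V : Y →L[𝕜] Y) :
    SchurCoupled (V.prodMap (.id 𝕜 Y₀)) V := by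
  refine ⟨.refl 𝕜 _, .inl 𝕜 Y Y₀ ∘L (.id 𝕜 Y - V), .fst 𝕜 Y Y₀, .refl 𝕜 _, ?_, ?_⟩
  · refine ContinuousLinearMap.ext fun p ↦ ?_
    ext <;> simp
  · refine ContinuousLinearMap.ext fun p ↦ ?_
    simp

theorem SchurCoupled.congr_left {U' : X₀ →L[𝕜] X₀} (h : EquivalentOperators U' U)
    (h' : SchurCoupled U V) : SchurCoupled U' V := by
  obtain ⟨e, f, h⟩ := h
  obtain ⟨A, B, C, D, rfl, rfl⟩ := h'
  refine ⟨(f.symm.trans A).trans e, (e : X →L[𝕜] X₀) ∘L B, C ∘L (f.symm : X₀ →L[𝕜] X), D, ?_, ?_⟩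
  · refine ContinuousLinearMap.ext fun x ↦ ?_
    have := h (f.symm x)
    simpa using this
  · refine ContinuousLinearMap.ext fun y ↦ ?_
    simp

theorem EquivalentWithExtensions.schurCoupled (h : EquivalentWithExtensions U V X₀ Y₀)
    (h0 : Subsingleton X₀ ∨ Subsingleton Y₀) : SchurCoupled U V := by
  rw [equivalentWithExtensions_iff] at h
  rcases h0 with h0 | h0
  · exact .congr_left ((equivalent_prodMap_id_subsingleton U).trans h) (schurCoupled_prod_id V)
  · exact .symm (.congr_left ((equivalent_prodMap_id_subsingleton V).trans h.symm)
      (schurCoupled_prod_id U))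

/-- The two block triangular factorizations of the coupling matrix show that `U ⊕ D` and `A ⊕ V`
are equivalent. -/
theorem SchurCoupled.equivalentWithExtensions (h : SchurCoupled U V) :
    EquivalentWithExtensions U V Y X := by
  obtain ⟨A, B, C, D, rfl, rfl⟩ := h
  rw [equivalentWithExtensions_iff]
  -- With `M` the coupling matrix, `M = P (U ⊕ D) Q = R (A ⊕ V) S` for unipotent triangular
  -- `P, Q, R, S`. Hence `(U ⊕ I) f = e (I ⊕ V)` for `f = (I ⊕ D) Q S⁻¹` and `e = P⁻¹ R (A ⊕ I)`;
  -- these are composed with the flip `Y ⊕ X → X ⊕ Y`.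
  let f : (Y × X) ≃L[𝕜] (X × Y) :=
    (((ContinuousLinearEquiv.refl 𝕜 Y).skewProd (.refl 𝕜 X)
      (-((A.symm : X →L[𝕜] X) ∘L B))).trans (.prodComm 𝕜 Y X)).trans
      ((ContinuousLinearEquiv.refl 𝕜 X).skewProd D C)
  let e : (Y × X) ≃L[𝕜] (X × Y) :=
    ((((ContinuousLinearEquiv.prodComm 𝕜 Y X).trans (A.skewProd (.refl 𝕜 Y) C)).trans
      (.prodComm 𝕜 X Y)).trans ((ContinuousLinearEquiv.refl 𝕜 Y).skewProd (.refl 𝕜 X)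
      (-(B ∘L (D.symm : Y →L[𝕜] Y))))).trans (.prodComm 𝕜 Y X)
  refine ⟨e, f, fun p ↦ ?_⟩
  ext
  · simp [e, f]
    abel
  · simp [e, f]
    abel

end Schur

/-! ### The equivalences -/

theorem theorem1p1 {𝕜 : Type k} [RCLike 𝕜]
    {X : Type u} [NormedAddCommGroup X] [NormedSpace 𝕜 X] [CompleteSpace X]
    {Y : Type v} [NormedAddCommGroup Y] [NormedSpace 𝕜 Y] [CompleteSpace Y]
    (U : X →L[𝕜] X) (V : Y →L[𝕜] Y) (hU : IsInessential U) (hV : IsInessential V) :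
    (EAE.{w, k, u, v} U V ↔ EAOE.{w, k, u, v} U V) ∧
    (EAOE.{w, k, u, v} U V ↔ SchurCoupled U V) ∧
    (EAE.{w, k, u, v} U V →
      FiniteDimensionalEAE.{w, k, u, v} U V ∧ FiniteDimensionalEAOE.{w, k, u, v} U V) := by
  have fd : EAE.{w, k, u, v} U V → FiniteDimensionalEAOE.{w, k, u, v} U V := by
    rintro ⟨X₀, _, _, _, Y₀, _, _, _, h⟩
    exact h.finiteDimensionalEAOE hU hV
  have drop : FiniteDimensionalEAOE.{w, k, u, v} U V → EAOE.{w, k, u, v} U V := by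
    rintro ⟨X₀, i₁, i₂, i₃, Y₀, i₄, i₅, i₆, h0, -, -, h⟩
    exact ⟨X₀, i₁, i₂, i₃, Y₀, i₄, i₅, i₆, h0, h⟩
  refine ⟨⟨fun h ↦ drop (fd h), ?_⟩, ⟨?_, fun h ↦ ?_⟩, fun h ↦ ⟨?_, fd h⟩⟩
  · rintro ⟨X₀, i₁, i₂, i₃, Y₀, i₄, i₅, i₆, -, h⟩
    exact ⟨X₀, i₁, i₂, i₃, Y₀, i₄, i₅, i₆, h⟩
  · rintro ⟨X₀, _, _, _, Y₀, _, _, _, h0, h⟩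
    exact h.schurCoupled h0
  · exact drop (h.equivalentWithExtensions.finiteDimensionalEAOE hU hV)
  · obtain ⟨X₀, i₁, i₂, i₃, Y₀, i₄, i₅, i₆, -, h₁, h₂, h⟩ := fd h
    exact ⟨X₀, i₁, i₂, i₃, Y₀, i₄, i₅, i₆, h₁, h₂, h⟩
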